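/- An \emph{interval exchange transformation with $n$ intervals} ($n$-IET) is the bijection $f:[0,1)\to[0,1)$ determined by bijections $\pi_0,\pi_1:\{1,\dots,n\}\to\{1,\dots,n\}$ and lengths $\lambda_1,\dots,\lambda_n>0$ with $\sum_\alpha\lambda_\alpha=1$ as follows: put $l_\alpha=\sum_{\pi_0(\beta)<\pi_0(\alpha)}\lambda_\beta$ and $l'_\alpha=\sum_{\pi_1(\beta)<\pi_1(\alpha)}\lambda_\beta$; then $f(x)=x-l_\alpha+l'_\alpha$ for $x\in I_\alpha=[l_\alpha,l_\alpha+\lambda_\alpha)$. The permutation $\rho=\pi_1\circ\pi_0^{-1}$ is its \emph{monodromy invariant}, written $(\rho(1),\dots,\rho(n))$. Such an $f$ satisfies the \emph{Keane condition} if $f^m(l_\alpha)\neq l_\beta$ for all $m\ge 1$ and all $\alpha,\beta\in\{1,\dots,n\}$ with $\pi_0(\beta)\neq 1$. An $n$-IET $h$ is an \emph{old transformation} if there are an $m$-IET $f$ with $m<n$ and an interval exchange transformation $g$ (with any number of intervals) such that $h=g\circ f\circ g^{-1}$; otherwise $h$ is a \emph{new transformation}. \textbf{Proposition.} Let $f$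 be an arbitrary $4$-IET with monodromy invariant $(4,3,2,1)$ which satisfies the Keane condition, and assume that $f^2=f\circ f$ is discontinuous at the point $f^{-1}(0)$. Then $f$ is a new transformation. -/

import Mathlib

/-- The half-open unit interval `[0,1)`, with its usual (subspace) topology. -/
abbrev UnitIco : Type := Set.Ico (0 : ℝ) 1

/-- Combinatorial data `(π₀, π₁)` and length data `len` of an interval exchange transformation
of `[0,1)` with `n` intervals. The alphabet and the positions `{1, …, n}` are modelled by `Fin n`
(so the first position is `0`): `π₀ α` and `π₁ α` are the positions of the interval with label `α`
before and after applying the map. -/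
structure IETData (n : ℕ) where
  π₀ : Equiv.Perm (Fin n)
  π₁ : Equiv.Perm (Fin n)
  len : Fin n → ℝ
  len_pos : ∀ α, 0 < len α
  len_sum : ∑ α, len α = 1

namespace IETData

variable {n : ℕ}

/-- The left endpoint of the interval labelled `α` when intervals of lengths `len`
are placed side by side from `0` in the order given by `π`. -/
def offset (π : Equiv.Perm (Fin n)) (len : Fin n → ℝ) (α : Fin n) : ℝ :=
  ∑ β with π β < π α, len β

theorem offset_add_le {π : Equiv.Perm (Fin n)} {len : Fin n → ℝ} (hpos : ∀ α, 0 < len α)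
    {α β : Fin n} (h : π α < π β) : offset π len α + len α ≤ offset π len β := by
  unfold offset
  rw [add_comm, ← Finset.sum_insert (by simp)]
  apply Finset.sum_le_sum_of_subset_of_nonneg
  · intro γ hγ
    simp only [Finset.mem_insert, Finset.mem_filter, Finset.mem_univ, true_and] at hγ ⊢
    rcases hγ with rfl | hγ
    · exact h
    · exact hγ.trans h
  · intro i _ _
    exact (hpos i).le

theorem offset_nonneg {π : Equiv.Perm (Fin n)} {len : Fin n → ℝ} (hpos : ∀ α, 0 < len α)
    (α : Fin n) : 0 ≤ offset π len α :=
  Finset.sum_nonneg fun i _ => (hpos i).le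

theorem offset_add_le_one {π : Equiv.Perm (Fin n)} {len : Fin n → ℝ} (hpos : ∀ α, 0 < len α)
    (hsum : ∑ α, len α = 1) (α : Fin n) : offset π len α + len α ≤ 1 := by
  unfold offset
  rw [add_comm, ← Finset.sum_insert (by simp), ← hsum]
  exact Finset.sum_le_sum_of_subset_of_nonneg (Finset.subset_univ _) fun i _ _ => (hpos i).le

theorem exists_mem_piece {π : Equiv.Perm (Fin n)} {len : Fin n → ℝ}
    (hsum : ∑ α, len α = 1) (x : UnitIco) :
    ∃ α, (x : ℝ) ∈ Set.Ico (offset π len α) (offset π len α + len α) := by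
  have key : ∀ k : ℕ, k ≤ n → (x : ℝ) < ∑ β with (π β : ℕ) < k, len β →
      ∃ α, (x : ℝ) ∈ Set.Ico (offset π len α) (offset π len α + len α) := by
    intro k
    induction k with
    | zero =>
      intro _ h
      simp only [Nat.not_lt_zero, Finset.filter_false, Finset.sum_empty] at h
      exact absurd x.2.1 (not_le.mpr h)
    | succ k ih =>
      intro hk h
      by_cases hx : (x : ℝ) < ∑ β with (π β : ℕ) < k, len β
      · exact ih (by omega) hx
      · refine ⟨π.symm ⟨k, hk⟩, ?_⟩
        have h1 : offset π len (π.symm ⟨k, hk⟩) = ∑ β with (π β : ℕ) < k, len β := by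
          unfold offset
          simp only [Equiv.apply_symm_apply, Fin.lt_def]
        have h2 : ∑ β with (π β : ℕ) < k + 1, len β =
            offset π len (π.symm ⟨k, hk⟩) + len (π.symm ⟨k, hk⟩) := by
          rw [h1, add_comm (Finset.sum _ _), ← Finset.sum_insert (by simp)]
          congr 1
          ext γ
          simp only [Finset.mem_insert, Finset.mem_filter, Finset.mem_univ, true_and,
            Equiv.eq_symm_apply, Fin.ext_iff]
          omega
        rw [h2] at h
        exact ⟨by rw [h1]; exact not_lt.mp hx, h⟩
  refine key n le_rfl ?_
  have h3 : ∑ β with (π β : ℕ) < n, len β = 1 := by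
    rw [← hsum]
    congr 1
    ext γ
    simp
  rw [h3]
  exact x.2.2

theorem piece_unique {π : Equiv.Perm (Fin n)} {len : Fin n → ℝ} (hpos : ∀ α, 0 < len α)
    {x : ℝ} {α β : Fin n} (hα : x ∈ Set.Ico (offset π len α) (offset π len α + len α))
    (hβ : x ∈ Set.Ico (offset π len β) (offset π len β + len β)) : α = β := by
  rcases lt_trichotomy (π α) (π β) with h | h | h
  · have := offset_add_le hpos h
    linarith [hα.2, hβ.1]
  · exact π.injective h
  · have := offset_add_le hpos h
    linarith [hβ.2, hα.1]

/-- The left endpoint of `I_α`, a real number. -/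
def left (D : IETData n) (α : Fin n) : ℝ := offset D.π₀ D.len α

/-- The left endpoint of the image of `I_α`. -/
def leftImage (D : IETData n) (α : Fin n) : ℝ := offset D.π₁ D.len α

/-- The subinterval `I_α`. -/
def piece (D : IETData n) (α : Fin n) : Set ℝ := Set.Ico (D.left α) (D.left α + D.len α)

/-- The label of the subinterval that contains the point `x`. -/
noncomputable def label (D : IETData n) (x : UnitIco) : Fin n :=
  (exists_mem_piece (π := D.π₀) D.len_sum x).choose

theorem mem_piece_label (D : IETData n) (x : UnitIco) : (x : ℝ) ∈ D.piece (D.label x) :=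
  (exists_mem_piece (π := D.π₀) D.len_sum x).choose_spec

theorem label_eq (D : IETData n) {x : UnitIco} {α : Fin n} (h : (x : ℝ) ∈ D.piece α) :
    D.label x = α :=
  piece_unique D.len_pos (D.mem_piece_label x) h

/-- The interval exchange transformation with the given data: it translates every `I_α` onto the
interval of the same length that starts at `D.leftImage α`. -/
noncomputable def toFun (D : IETData n) (x : UnitIco) : UnitIco :=
  ⟨(x : ℝ) - D.left (D.label x) + D.leftImage (D.label x), by
    have h := D.mem_piece_label x
    have h0 : 0 ≤ D.leftImage (D.label x) := offset_nonneg D.len_pos _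
    have h1 : D.leftImage (D.label x) + D.len (D.label x) ≤ 1 :=
      offset_add_le_one D.len_pos D.len_sum _
    simp only [piece, Set.mem_Ico] at h
    constructor <;> linarith [h.1, h.2]⟩

/-- The data of the inverse map: the two orderings are exchanged. -/
def swap (D : IETData n) : IETData n := ⟨D.π₁, D.π₀, D.len, D.len_pos, D.len_sum⟩

theorem swap_toFun_toFun (D : IETData n) (x : UnitIco) : D.swap.toFun (D.toFun x) = x := by
  have h := D.mem_piece_label x
  simp only [piece, Set.mem_Ico] at h
  have hl : D.swap.label (D.toFun x) = D.label x := by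
    apply label_eq
    change D.leftImage (D.label x) ≤ (x : ℝ) - D.left (D.label x) + D.leftImage (D.label x) ∧
      (x : ℝ) - D.left (D.label x) + D.leftImage (D.label x) <
        D.leftImage (D.label x) + D.len (D.label x)
    constructor <;> linarith [h.1, h.2]
  apply Subtype.ext
  change ((x : ℝ) - D.left (D.label x) + D.leftImage (D.label x)) -
    D.leftImage (D.swap.label (D.toFun x)) + D.left (D.swap.label (D.toFun x)) = x
  rw [hl]
  ring

/-- The interval exchange transformation with the given data, as a bijection of `[0,1)`. -/
noncomputable def toPerm (D : IETData n) : Equiv.Perm UnitIco where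
  toFun := D.toFun
  invFun := D.swap.toFun
  left_inv := D.swap_toFun_toFun
  right_inv := D.swap.swap_toFun_toFun

/-- The monodromy invariant `ρ = π₁ ∘ π₀⁻¹`. -/
def monodromy (D : IETData n) : Equiv.Perm (Fin n) := D.π₁ * D.π₀⁻¹

/-- The left endpoint `∂I_α`, as a point of `[0,1)`. -/
def leftPt (D : IETData n) (α : Fin n) : UnitIco :=
  ⟨D.left α, offset_nonneg D.len_pos α,
    lt_of_lt_of_le (lt_add_of_pos_right _ (D.len_pos α))
      (offset_add_le_one D.len_pos D.len_sum α)⟩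

/-- The Keane condition: `f^m(∂I_α) ≠ ∂I_β` for all `m ≥ 1` and all `α`, `β` such that `I_β` is
not the leftmost interval. -/
def Keane (D : IETData n) : Prop :=
  ∀ m : ℕ, 1 ≤ m → ∀ α β : Fin n, (D.π₀ β : ℕ) ≠ 0 → D.toPerm^[m] (D.leftPt α) ≠ D.leftPt β

end IETData

/-- `f` is an interval exchange transformation with `n` intervals. -/
def IsIET (n : ℕ) (f : Equiv.Perm UnitIco) : Prop := ∃ D : IETData n, D.toPerm = f

/-- The `n`-interval exchange transformation `h` is an old transformation: `h = g f g⁻¹` for some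
interval exchange transformation `f` with fewer than `n` intervals and some interval exchange
transformation `g` with any number of intervals. -/
def IsOldTransformation (n : ℕ) (h : Equiv.Perm UnitIco) : Prop :=
  IsIET n h ∧ ∃ m : ℕ, m < n ∧ ∃ f : Equiv.Perm UnitIco, IsIET m f ∧
    ∃ (k : ℕ) (g : Equiv.Perm UnitIco), IsIET k g ∧ h = g * f * g⁻¹

/-- An `n`-interval exchange transformation that is not old is a new transformation. -/
def IsNewTransformation (n : ℕ) (h : Equiv.Perm UnitIco) : Prop :=
  IsIET n h ∧ ¬ IsOldTransformation n h

/-!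
The invariant that separates new from old here is the growth rate of the number of discontinuities
of the iterates.

An `m`-interval exchange `φ` has at most `m - 1` discontinuities, so `φ ^ N` has at most
`(m - 1) * N`, and conjugating by an interval exchange `g` adds at most the number of
discontinuities of `g` and of `g⁻¹`, a constant independent of `N`
(`encard_discontinuities_pow_le`, `encard_discontinuities_mul_le`).

Conversely, let `f` be a `4`-interval exchange with monodromy `(4,3,2,1)` satisfying the Keane
condition, with interval endpoints `0 = l₁ < l₂ < l₃ < l₄`. The points `f^{-k}(l_β)` with `k < N`
and `β = 2, 3, 4` are `3 * N` distinct points, and `f ^ N` is discontinuous at each of them: up to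
time `k` no endpoint is met, so the left limit follows the orbit; at `l₄`, `l₃`, `l₂` the left limit
jumps to `f(l₂)`, `f(l₁)` and `1` respectively (the last one is sent to `f(l₃)` one step later);
afterwards no endpoint is ever met again, so the left limit follows an orbit different from the
orbit of `l_β` (`not_continuousAt_pow_of_keane`). Hence `3 * N ≤ (m - 1) * N + C` for all `N`,
which forces `m ≥ 4`.

Left limits are expressed by the filters `leftNhds t`, which make sense also for `t = 1`.
-/

open Filter Topology

/-! ### Discontinuities of permutations of `[0,1)` -/

/-- The set of points at which `f` is discontinuous, for the subspace topology of `[0,1)`. -/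
def discontinuities (f : Equiv.Perm UnitIco) : Set UnitIco := {x | ¬ ContinuousAt f x}

theorem encard_discontinuities_mul_le (f g : Equiv.Perm UnitIco) :
    (discontinuities (f * g)).encard ≤
      (discontinuities f).encard + (discontinuities g).encard := by
  have h : discontinuities (f * g) ⊆ g ⁻¹' discontinuities f ∪ discontinuities g := by
    intro x hx
    by_contra hn
    simp only [discontinuities, Set.mem_union, Set.mem_preimage, Set.mem_ofPred_eq, not_or,
      not_not] at hn
    exact hx (ContinuousAt.comp (f := g) (g := f) hn.1 hn.2)
  refine (Set.encard_le_encard h).trans ((Set.encard_union_le _ _).trans ?_)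
  rw [← Equiv.image_symm_eq_preimage, g.symm.injective.encard_image]

theorem encard_discontinuities_pow_le {f : Equiv.Perm UnitIco} {d : ℕ}
    (hf : (discontinuities f).encard ≤ d) (N : ℕ) :
    (discontinuities (f ^ N)).encard ≤ (d * N : ℕ) := by
  induction N with
  | zero =>
    have : discontinuities (f ^ 0) = ∅ :=
      Set.eq_empty_of_forall_notMem fun x hx => hx continuousAt_id
    rw [this, Set.encard_empty]
    exact zero_le
  | succ N ih =>
    rw [pow_succ]
    refine (encard_discontinuities_mul_le _ _).trans ((add_le_add ih hf).trans ?_)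
    rw [Nat.mul_succ]
    push_cast
    exact le_rfl

/-! ### Left-sided neighbourhoods -/

/-- The trace on `[0,1)` of the punctured left neighbourhoods of the real number `t`. The case
`t = 1` describes approaching the missing right endpoint. -/
def leftNhds (t : ℝ) : Filter UnitIco := comap Subtype.val (𝓝[<] t)

theorem leftNhds_neBot {t : ℝ} (h0 : 0 < t) (h1 : t ≤ 1) : (leftNhds t).NeBot := by
  refine comap_neBot fun s hs => ?_
  have hs' : s ∩ Set.Ioo 0 t ∈ 𝓝[<] t := inter_mem hs (Ioo_mem_nhdsLT h0)
  obtain ⟨x, hx, hx0, hxt⟩ := nonempty_of_mem hs'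
  exact ⟨⟨x, hx0.le, hxt.trans_le h1⟩, hx⟩

theorem leftNhds_le_nhds (x : UnitIco) : leftNhds x ≤ 𝓝 x := by
  rw [nhds_subtype_eq_comap]
  exact comap_mono nhdsWithin_le_nhds

theorem not_continuousAt_of_tendsto_leftNhds {f : UnitIco → UnitIco} {x : UnitIco} {t : ℝ}
    (hx : (0 : ℝ) < x) (h : Tendsto f (leftNhds x) (leftNhds t)) (ht : (f x : ℝ) ≠ t) :
    ¬ ContinuousAt f x := by
  intro hc
  have := leftNhds_neBot hx x.2.2.le
  have h1 : Tendsto (fun y => (f y : ℝ)) (leftNhds x) (𝓝 (f x : ℝ)) :=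
    (continuous_subtype_val.tendsto _).comp (hc.mono_left (leftNhds_le_nhds x))
  have h2 : Tendsto (fun y => (f y : ℝ)) (leftNhds x) (𝓝 t) :=
    (tendsto_comap.mono_right nhdsWithin_le_nhds).comp h
  exact ht (tendsto_nhds_unique h1 h2)

namespace IETData

variable {n : ℕ}

/-! ### Endpoints of the intervals -/

theorem offset_eq_zero {π : Equiv.Perm (Fin n)} {len : Fin n → ℝ} {α : Fin n}
    (h : (π α : ℕ) = 0) : offset π len α = 0 := by
  unfold offset
  rw [Finset.filter_false_of_mem, Finset.sum_empty]
  intro β _ hβ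
  rw [Fin.lt_def] at hβ
  omega

theorem offset_add_eq {π : Equiv.Perm (Fin n)} {len : Fin n → ℝ} {α β : Fin n}
    (h : (π α : ℕ) + 1 = π β) : offset π len α + len α = offset π len β := by
  unfold offset
  rw [add_comm, ← Finset.sum_insert (by simp)]
  congr 1
  ext γ
  have : γ = α ↔ (π γ : ℕ) = π α := by rw [← Fin.ext_iff, π.apply_eq_iff_eq]
  simp only [Finset.mem_insert, Finset.mem_filter, Finset.mem_univ, true_and, Fin.lt_def, this]
  omega

theorem offset_add_eq_one {π : Equiv.Perm (Fin n)} {len : Fin n → ℝ} (hsum : ∑ α, len α = 1)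
    {α : Fin n} (h : (π α : ℕ) + 1 = n) : offset π len α + len α = 1 := by
  unfold offset
  rw [add_comm, ← Finset.sum_insert (by simp), ← hsum]
  congr 1
  ext γ
  have : γ = α ↔ (π γ : ℕ) = π α := by rw [← Fin.ext_iff, π.apply_eq_iff_eq]
  simp only [Finset.mem_insert, Finset.mem_filter, Finset.mem_univ, true_and, Fin.lt_def, this,
    iff_true]
  have := (π γ).isLt
  omega

theorem leftPt_injective (D : IETData n) : Function.Injective D.leftPt := by
  intro α β h
  have hl : D.left α = D.left β := congrArg Subtype.val h
  refine piece_unique (π := D.π₀) (x := D.left α) D.len_pos ⟨le_rfl, ?_⟩ ⟨hl.ge, ?_⟩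
  · exact lt_add_of_pos_right _ (D.len_pos α)
  · exact hl.trans_lt (lt_add_of_pos_right _ (D.len_pos β))

theorem toPerm_apply_of_mem (D : IETData n) {x : UnitIco} {α : Fin n}
    (h : (x : ℝ) ∈ D.piece α) : (D.toPerm x : ℝ) = x - D.left α + D.leftImage α := by
  rw [← D.label_eq h]
  rfl

theorem toPerm_leftPt (D : IETData n) (α : Fin n) :
    (D.toPerm (D.leftPt α) : ℝ) = D.leftImage α := by
  rw [D.toPerm_apply_of_mem (α := α) ⟨le_rfl, lt_add_of_pos_right _ (D.len_pos α)⟩]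
  exact (congrArg (· + _) (sub_self (D.left α))).trans (zero_add _)

theorem left_pos (D : IETData n) {α : Fin n} (h : (D.π₀ α : ℕ) ≠ 0) : 0 < D.left α := by
  have hlt : D.π₀ (D.π₀.symm ⟨0, α.pos⟩) < D.π₀ α := by
    rw [Equiv.apply_symm_apply, Fin.lt_def]
    exact Nat.pos_of_ne_zero h
  have := offset_add_le D.len_pos hlt
  have h0 := offset_nonneg (π := D.π₀) D.len_pos (D.π₀.symm ⟨0, α.pos⟩)
  have := D.len_pos (D.π₀.symm ⟨0, α.pos⟩)
  unfold left
  linarith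

/-! ### Upper bound for the number of discontinuities -/

theorem continuousAt_toPerm (D : IETData n) {x : UnitIco}
    (hx : ∀ α, (D.π₀ α : ℕ) ≠ 0 → x ≠ D.leftPt α) : ContinuousAt D.toPerm x := by
  have hm := D.mem_piece_label x
  set α := D.label x
  -- At the left end of the leftmost interval there are no points of `[0,1)` further left.
  have hev : ∀ᶠ y : UnitIco in 𝓝 x, (y : ℝ) ∈ D.piece α := by
    have hup : ∀ᶠ y : UnitIco in 𝓝 x, (y : ℝ) < D.left α + D.len α :=
      continuous_subtype_val.continuousAt.eventually_lt continuousAt_const hm.2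
    by_cases h0 : (D.π₀ α : ℕ) = 0
    · filter_upwards [hup] with y hy
      exact ⟨(offset_eq_zero h0).le.trans y.2.1, hy⟩
    · have hlt : D.left α < x :=
        lt_of_le_of_ne hm.1 fun h => hx α h0 (Subtype.ext h.symm)
      have hlo : ∀ᶠ y : UnitIco in 𝓝 x, D.left α < y :=
        continuousAt_const.eventually_lt continuous_subtype_val.continuousAt hlt
      filter_upwards [hup, hlo] with y hy hy'
      exact ⟨hy'.le, hy⟩
  rw [Topology.IsInducing.subtypeVal.continuousAt_iff]
  have hc : ContinuousAt (fun y : UnitIco => (y : ℝ) - D.left α + D.leftImage α) x := by fun_prop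
  refine hc.congr ?_
  filter_upwards [hev] with y hy
  exact (D.toPerm_apply_of_mem hy).symm

theorem encard_discontinuities_le (D : IETData n) :
    (discontinuities D.toPerm).encard ≤ (n - 1 : ℕ) := by
  have h : discontinuities D.toPerm ⊆
      D.leftPt '' ((Finset.univ.filter fun α => (D.π₀ α : ℕ) ≠ 0 : Finset (Fin n)) : Set _) := by
    intro x hx
    by_contra hn
    refine hx (D.continuousAt_toPerm fun α hα hxα => hn ⟨α, ?_, hxα.symm⟩)
    simpa using hα
  refine (Set.encard_le_encard h).trans ((Set.encard_image_le _ _).trans ?_)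
  rw [Set.encard_coe_eq_coe_finsetCard, Nat.cast_le]
  rcases n with _ | n
  · simp
  · refine (Finset.card_le_card (t := Finset.univ.erase (D.π₀.symm 0)) ?_).trans (by simp)
    intro α hα
    simp only [Finset.mem_filter, Finset.mem_univ, true_and, Finset.mem_erase, and_true] at hα ⊢
    rintro rfl
    simp at hα

/-! ### Left limits along orbits -/

theorem tendsto_leftNhds_of_mem (D : IETData n) {α : Fin n} {t : ℝ}
    (ht : t ∈ Set.Ioc (D.left α) (D.left α + D.len α)) :
    Tendsto D.toPerm (leftNhds t) (leftNhds (t - D.left α + D.leftImage α)) := by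
  refine tendsto_comap_iff.2 ?_
  have hev : ∀ᶠ y : UnitIco in leftNhds t, (y : ℝ) ∈ D.piece α := by
    filter_upwards [preimage_mem_comap (Ioo_mem_nhdsLT ht.1)] with y hy
    exact ⟨hy.1.le, hy.2.trans_le ht.2⟩
  have hc : Tendsto (fun y : ℝ => y - D.left α + D.leftImage α) (𝓝[<] t)
      (𝓝[<] (t - D.left α + D.leftImage α)) := by
    refine tendsto_nhdsWithin_iff.2 ⟨?_, ?_⟩
    · have : Continuous fun y : ℝ => y - D.left α + D.leftImage α := by fun_prop
      exact this.continuousAt.tendsto.mono_left nhdsWithin_le_nhds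
    · filter_upwards [self_mem_nhdsWithin] with y hy
      simp only [Set.mem_Iio] at hy ⊢
      linarith
  refine (hc.comp tendsto_comap).congr' ?_
  filter_upwards [hev] with y hy
  exact (D.toPerm_apply_of_mem hy).symm

theorem tendsto_leftNhds_right_end (D : IETData n) (α : Fin n) :
    Tendsto D.toPerm (leftNhds (D.left α + D.len α)) (leftNhds (D.leftImage α + D.len α)) := by
  have := D.tendsto_leftNhds_of_mem (α := α) ⟨lt_add_of_pos_right _ (D.len_pos α), le_rfl⟩
  rwa [show D.left α + D.len α - D.left α + D.leftImage α = D.leftImage α + D.len α by ring]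
    at this

theorem tendsto_leftNhds_of_ne (D : IETData n) {x : UnitIco} (hx : ∀ α, x ≠ D.leftPt α) :
    Tendsto D.toPerm (leftNhds x) (leftNhds (D.toPerm x)) := by
  have hm := D.mem_piece_label x
  rw [D.toPerm_apply_of_mem hm]
  exact D.tendsto_leftNhds_of_mem
    ⟨lt_of_le_of_ne hm.1 fun h => hx _ (Subtype.ext h.symm), hm.2.le⟩

/-- As long as the orbit of `x` meets no left endpoint, the left limit of the iterate at `x` is the
iterate of `x`. -/
theorem tendsto_leftNhds_pow (D : IETData n) {x : UnitIco} (m : ℕ)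
    (hx : ∀ j < m, ∀ α, (D.toPerm ^ j) x ≠ D.leftPt α) :
    Tendsto (D.toPerm ^ m : Equiv.Perm UnitIco) (leftNhds x)
      (leftNhds ((D.toPerm ^ m) x)) := by
  induction m with
  | zero => exact tendsto_id
  | succ m ih =>
    rw [pow_succ']
    exact (D.tendsto_leftNhds_of_ne (hx m m.lt_succ_self)).comp
      (ih fun j hj => hx j (hj.trans m.lt_succ_self))

/-! ### Consequences of the Keane condition -/

theorem Keane.pow_ne {D : IETData n} (hK : D.Keane) {m : ℕ} (hm : m ≠ 0) (α : Fin n) {β : Fin n}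
    (hβ : (D.π₀ β : ℕ) ≠ 0) : (D.toPerm ^ m) (D.leftPt α) ≠ D.leftPt β := by
  rw [Equiv.Perm.coe_pow]
  exact hK m (Nat.one_le_iff_ne_zero.2 hm) α β hβ

/-- The forward orbit of a left endpoint meets no left endpoint again, except that the point `δ`
with image `0` does so at time `1`. -/
theorem Keane.pow_ne_leftPt {D : IETData n} (hK : D.Keane) {δ : Fin n}
    (hδ : (D.π₀ δ : ℕ) ≠ 0) (hδ1 : (D.π₁ δ : ℕ) = 0) {m : ℕ} (hm : m ≠ 0) {α : Fin n}
    (hα : α ≠ δ) (β : Fin n) : (D.toPerm ^ m) (D.leftPt α) ≠ D.leftPt β := by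
  by_cases hβ : (D.π₀ β : ℕ) = 0
  · intro h
    have h0 : D.leftPt β = D.toPerm (D.leftPt δ) := by
      apply Subtype.ext
      rw [toPerm_leftPt]
      exact (offset_eq_zero hβ).trans (offset_eq_zero hδ1).symm
    obtain ⟨m, rfl⟩ := Nat.exists_eq_succ_of_ne_zero hm
    rw [h0, pow_succ', Equiv.Perm.mul_apply, D.toPerm.apply_eq_iff_eq] at h
    rcases Nat.eq_zero_or_pos m with rfl | hm'
    · exact hα (D.leftPt_injective h)
    · exact hK.pow_ne hm'.ne' α hδ h
  · exact hK.pow_ne hm α hβ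

/-- Backward orbits of nonzero left endpoints, indexed by the time and the endpoint, do not
overlap. -/
theorem Keane.backward_injective {D : IETData n} (hK : D.Keane) {k k' : ℕ} {β β' : Fin n}
    (hβ : (D.π₀ β : ℕ) ≠ 0) (hβ' : (D.π₀ β' : ℕ) ≠ 0)
    (h : (D.toPerm ^ k).symm (D.leftPt β) = (D.toPerm ^ k').symm (D.leftPt β')) :
    k = k' ∧ β = β' := by
  wlog hkk : k ≤ k' generalizing k k' β β'
  · exact (this hβ' hβ h.symm (le_of_not_ge hkk)).imp Eq.symm Eq.symm
  obtain ⟨d, rfl⟩ := Nat.exists_eq_add_of_le hkk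
  rw [Equiv.eq_symm_apply, add_comm, pow_add, Equiv.Perm.mul_apply, Equiv.apply_symm_apply] at h
  rcases Nat.eq_zero_or_pos d with rfl | hd
  · exact ⟨rfl, D.leftPt_injective h⟩
  · exact absurd h (hK.pow_ne hd.ne' β hβ')

/-- If the left limit of `f ^ (r + 1)` at a nonzero left endpoint `l_β` differs from the value
there, then `f ^ (k + r + 1)` is discontinuous at `f^{-k}(l_β)`. -/
theorem Keane.not_continuousAt_backward {D : IETData n} (hK : D.Keane) {β : Fin n}
    (hβ : (D.π₀ β : ℕ) ≠ 0) (k r : ℕ) {t : ℝ}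
    (h : Tendsto (D.toPerm ^ (r + 1) : Equiv.Perm UnitIco) (leftNhds (D.left β)) (leftNhds t))
    (ht : ((D.toPerm ^ (r + 1)) (D.leftPt β) : ℝ) ≠ t) :
    ¬ ContinuousAt (D.toPerm ^ (r + 1 + k) : Equiv.Perm UnitIco)
      ((D.toPerm ^ k).symm (D.leftPt β)) := by
  set y := (D.toPerm ^ k).symm (D.leftPt β)
  have hy : (D.toPerm ^ k) y = D.leftPt β := Equiv.apply_symm_apply _ _
  have havoid : ∀ j ≤ k, ∀ α, (j ≠ k ∨ (D.π₀ α : ℕ) = 0) → (D.toPerm ^ j) y ≠ D.leftPt α := by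
    intro j hj α hα hjα
    obtain ⟨d, rfl⟩ := Nat.exists_eq_add_of_le hj
    rw [add_comm, pow_add, Equiv.Perm.mul_apply, hjα] at hy
    rcases Nat.eq_zero_or_pos d with rfl | hd
    · have := D.leftPt_injective hy
      subst this
      simp [hβ] at hα
    · exact hK.pow_ne hd.ne' α hβ hy
  have hy0 : (0 : ℝ) < y := by
    refine lt_of_le_of_ne y.2.1 fun h0 => ?_
    let α₀ := D.π₀.symm ⟨0, β.pos⟩
    have hα₀ : (D.π₀ α₀ : ℕ) = 0 := by simp [α₀]
    exact havoid 0 k.zero_le α₀ (Or.inr hα₀)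
      (Subtype.ext (h0.symm.trans (offset_eq_zero hα₀).symm))
  have h1 := D.tendsto_leftNhds_pow k fun j hj α => havoid j hj.le α (Or.inl hj.ne)
  rw [hy] at h1
  refine not_continuousAt_of_tendsto_leftNhds hy0 (t := t) ?_ ?_
  · rw [pow_add]
    exact h.comp h1
  · rwa [pow_add, Equiv.Perm.mul_apply, hy]

/-! ### Lower bound for the number of discontinuities -/

section Reversal

variable {D : IETData 4}

/-- The image order of the intervals is the reverse of their original order. -/
theorem π₁_add_π₀ (hρ : ⇑D.monodromy = ![3, 2, 1, 0]) (α : Fin 4) :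
    (D.π₁ α : ℕ) + D.π₀ α = 3 := by
  have h : D.π₁ α = ![3, 2, 1, 0] (D.π₀ α) := by
    rw [← hρ]
    simp [monodromy]
  rw [h]
  generalize D.π₀ α = i
  fin_cases i <;> rfl

theorem not_continuousAt_pow_of_keane (hρ : ⇑D.monodromy = ![3, 2, 1, 0]) (hK : D.Keane)
    {β : Fin 4} (hβ : (D.π₀ β : ℕ) ≠ 0) {k N : ℕ} (hk : k < N) :
    ¬ ContinuousAt (D.toPerm ^ N : Equiv.Perm UnitIco) ((D.toPerm ^ k).symm (D.leftPt β)) := by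
  obtain ⟨r, rfl⟩ : ∃ r, N = r + 1 + k := ⟨N - k - 1, by omega⟩
  have hrev := π₁_add_π₀ hρ
  -- The labels in their original order, and the interval whose image is leftmost.
  obtain ⟨a, ha⟩ : ∃ a : Fin 4 → Fin 4, ∀ i, D.π₀ (a i) = i :=
    ⟨D.π₀.symm, D.π₀.apply_symm_apply⟩
  have ha3 : (D.π₀ (a 3) : ℕ) ≠ 0 := by simp [ha]
  have ha3' : (D.π₁ (a 3) : ℕ) = 0 := by
    have := hrev (a 3)
    simp only [ha] at this
    simpa using this
  have follow : ∀ {α : Fin 4}, α ≠ a 3 → ∀ s : ℕ,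
      Tendsto (D.toPerm ^ s : Equiv.Perm UnitIco) (leftNhds (D.leftImage α))
        (leftNhds ((D.toPerm ^ (s + 1)) (D.leftPt α))) := by
    intro α hα s
    have := D.tendsto_leftNhds_pow (x := D.toPerm (D.leftPt α)) s fun j _ γ => by
      have := hK.pow_ne_leftPt ha3 ha3' (Nat.succ_ne_zero j) hα γ
      rwa [pow_succ, Equiv.Perm.mul_apply] at this
    rwa [toPerm_leftPt, ← Equiv.Perm.mul_apply, ← pow_succ] at this
  obtain ⟨γ, hγ⟩ : ∃ γ, (D.π₀ γ : ℕ) + 1 = D.π₀ β :=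
    ⟨D.π₀.symm ⟨D.π₀ β - 1, by omega⟩, by simp; omega⟩
  -- `γ` labels the interval immediately to the left of `l_β`.
  have hstep : Tendsto D.toPerm (leftNhds (D.left β)) (leftNhds (D.leftImage γ + D.len γ)) := by
    have := D.tendsto_leftNhds_right_end γ
    rwa [left, offset_add_eq hγ] at this
  by_cases hγ0 : (D.π₀ γ : ℕ) = 0
  · -- The left limit at `l_β` is the missing endpoint `1`.
    have h1 : D.leftImage γ + D.len γ = 1 :=
      offset_add_eq_one D.len_sum (by have := hrev γ; omega)
    rw [h1] at hstep
    rcases r with _ | r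
    · exact hK.not_continuousAt_backward hβ k 0 hstep
        ((D.toPerm ^ (0 + 1)) (D.leftPt β)).2.2.ne
    · have hlast : Tendsto D.toPerm (leftNhds 1) (leftNhds (D.leftImage (a 2))) := by
        have := D.tendsto_leftNhds_right_end (a 3)
        have e1 : D.left (a 3) + D.len (a 3) = 1 :=
          offset_add_eq_one D.len_sum (by simp [ha])
        have e2 : D.leftImage (a 3) + D.len (a 3) = D.leftImage (a 2) := by
          refine offset_add_eq ?_
          have h2 := hrev (a 2)
          rw [ha] at h2
          simp at h2
          omega
        rwa [e1, e2] at this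
      have ha23 : a 2 ≠ a 3 := fun h => by
        have := congrArg D.π₀ h
        simp [ha] at this
      refine hK.not_continuousAt_backward hβ k (r + 1)
        (t := (D.toPerm ^ (r + 1)) (D.leftPt (a 2))) ?_ ?_
      · rw [pow_succ, pow_succ]
        exact (follow ha23 r).comp (hlast.comp hstep)
      · intro h
        have h' := Subtype.ext h
        rw [pow_succ _ (r + 1), Equiv.Perm.mul_apply, Equiv.apply_eq_iff_eq] at h'
        exact hK.pow_ne one_ne_zero β (β := a 2) (by simp [ha]) (by rwa [pow_one])
  · -- The left limit at `l_β` is `f(l_δ)`, where `δ` precedes `γ`.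
    obtain ⟨δ, hδ⟩ : ∃ δ, (D.π₀ δ : ℕ) + 1 = D.π₀ γ :=
      ⟨D.π₀.symm ⟨D.π₀ γ - 1, by omega⟩, by simp; omega⟩
    have e : D.leftImage γ + D.len γ = D.leftImage δ := by
      refine offset_add_eq ?_
      have := hrev γ
      have := hrev δ
      omega
    rw [e] at hstep
    have hδ3 : δ ≠ a 3 := by
      rintro rfl
      rw [ha] at hδ
      have := (D.π₀ γ).isLt
      simp at hδ
      omega
    refine hK.not_continuousAt_backward hβ k r (t := (D.toPerm ^ (r + 1)) (D.leftPt δ)) ?_ ?_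
    · rw [pow_succ]
      exact (follow hδ3 r).comp hstep
    · intro h
      have h' := D.leftPt_injective ((Equiv.injective _) (Subtype.ext h))
      subst h'
      omega

theorem le_encard_discontinuities_pow (hρ : ⇑D.monodromy = ![3, 2, 1, 0]) (hK : D.Keane)
    (N : ℕ) : ((3 * N : ℕ) : ℕ∞) ≤ (discontinuities (D.toPerm ^ N)).encard := by
  let φ : Fin 3 × Fin N → UnitIco := fun p =>
    (D.toPerm ^ (p.2 : ℕ)).symm (D.leftPt (D.π₀.symm p.1.succ))
  have hne : ∀ i : Fin 3, (D.π₀ (D.π₀.symm i.succ) : ℕ) ≠ 0 := fun i => by simp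
  have hφ : Function.Injective φ := by
    rintro ⟨i, k⟩ ⟨i', k'⟩ h
    obtain ⟨h1, h2⟩ := hK.backward_injective (hne i) (hne i') h
    exact Prod.ext (Fin.succ_injective _ (D.π₀.symm.injective h2)) (Fin.ext h1)
  have hsub : Set.range φ ⊆ discontinuities (D.toPerm ^ N) := by
    rintro _ ⟨⟨i, k⟩, rfl⟩
    exact not_continuousAt_pow_of_keane hρ hK (hne i) k.isLt
  refine le_trans (le_of_eq ?_) (Set.encard_le_encard hsub)
  rw [← Set.image_univ, hφ.encard_image, Set.encard_univ]
  simp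

end Reversal

end IETData

theorem mainTheorem5 (D : IETData 4)
    (hρ : ⇑D.monodromy = ![3, 2, 1, 0])
    (hKeane : D.Keane)
    (hdisc : ¬ ContinuousAt (D.toPerm ∘ D.toPerm)
      (D.toPerm.symm ⟨0, Set.left_mem_Ico.mpr one_pos⟩)) :
    IsNewTransformation 4 D.toPerm := by
  refine ⟨⟨D, rfl⟩, ?_⟩
  rintro ⟨-, m, hm, _, ⟨E, rfl⟩, k, _, ⟨G, rfl⟩, h⟩
  -- Any `N` exceeding the constant `2 * (k - 1)` contributed by the conjugacy will do.
  let N := 2 * (k - 1) + 1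
  have hlow := IETData.le_encard_discontinuities_pow hρ hKeane N
  have hE : (discontinuities E.toPerm).encard ≤ (2 : ℕ) :=
    E.encard_discontinuities_le.trans (by exact_mod_cast (by omega : m - 1 ≤ 2))
  have hG : (discontinuities G.toPerm⁻¹).encard ≤ (k - 1 : ℕ) :=
    G.swap.encard_discontinuities_le
  have hup : (discontinuities (D.toPerm ^ N)).encard ≤
      (k - 1 : ℕ) + (2 * N : ℕ) + (k - 1 : ℕ) := by
    rw [h, conj_pow]
    refine (encard_discontinuities_mul_le _ _).trans (add_le_add ?_ hG)
    exact (encard_discontinuities_mul_le _ _).trans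
      (add_le_add G.encard_discontinuities_le (encard_discontinuities_pow_le hE N))
  have hle : 3 * N ≤ (k - 1) + 2 * N + (k - 1) := by exact_mod_cast hlow.trans hup
  omega
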